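/- Let $p$ be a prime and let $G$ be a finite $p$-group of nilpotence class $3$ that is a Camina group, i.e. for every $g \in G \setminus G'$ the conjugacy class of $g$ is the coset $gG'$. Write $G_3 = [G',G]$. For $a \in G\setminus G'$ let $A(a) = \{x \in G \mid [a,x] \in G_3\}$, i.e. $A(a)/G_3 = C_{G/G_3}(aG_3)$, and put $\mathcal{A}(G) = \{A(a) \mid a \in G\setminus G'\}$. For a subgroup $N \le G_3$ with $|G_3:N| = p$ (such an $N$ is central, hence normal, in $G$) let $C(N)$ be the subgroup of $G$ with $N \le C(N)$ and $C(N)/N = C_{G/N}(G'/N)$, and put $\mathcal{C}(G) = \{C(N) \mid N \le G_3,\ |G_3:N| = p\}$. If $\mathcal{C}(G)$ is a proper subset of $\mathcal{A}(G)$, then $|G_3| \le |G:G'|^{1/2}$. -/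

import Mathlib

namespace CaminaGroups

/-- `G` is a Camina group: the conjugacy class of every `g` outside the derived subgroup `G'`
is the whole coset `gG'`. -/
def IsCamina (G : Type*) [Group G] : Prop :=
  ∀ g : G, g ∉ commutator G → conjugatesOf g = (fun z => g * z) '' (commutator G : Set G)

/-- The third term `G_3 = [G', G]` of the lower central series (with `G_2 = G'`). -/
abbrev third (G : Type*) [Group G] : Subgroup G :=
  ⁅commutator G, (⊤ : Subgroup G)⁆

/-- For a normal subgroup `N` and a subset `S` of `G`, the full preimage in `G` of the
centralizer in `G/N` of the image of `S`. -/
def centralizerMod {G : Type*} [Group G] (N : Subgroup G) [N.Normal] (S : Set G) : Subgroup G :=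
  (Subgroup.centralizer (QuotientGroup.mk' N '' S)).comap (QuotientGroup.mk' N)

/-- Membership in commutator form. -/
theorem mem_centralizerMod {G : Type*} [Group G] {N : Subgroup G} [N.Normal] {S : Set G} {x : G} :
    x ∈ centralizerMod N S ↔ ∀ s ∈ S, s⁻¹ * x⁻¹ * s * x ∈ N := by
  simp only [centralizerMod, Subgroup.mem_comap, Subgroup.mem_centralizer_iff,
    Set.forall_mem_image]
  refine forall₂_congr fun s _ => ?_
  have e : s⁻¹ * x⁻¹ * s * x = (x * s)⁻¹ * (s * x) := by group
  rw [e, ← QuotientGroup.eq, eq_comm]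
  rfl

/-- `A(a)`, the subgroup with `A(a)/G_3 = C_{G/G_3}(aG_3)`. -/
def subgroupA {G : Type*} [Group G] (a : G) : Subgroup G :=
  centralizerMod (third G) {a}

/-- `C(N)`, the subgroup with `C(N)/N = C_{G/N}(G'/N)`. -/
def subgroupC {G : Type*} [Group G] (N : Subgroup G) [N.Normal] : Subgroup G :=
  centralizerMod N (commutator G : Set G)

/-- `𝒜(G) = {A(a) | a ∈ G ∖ G'}`. -/
def familyA (G : Type*) [Group G] : Set (Subgroup G) :=
  {A | ∃ a : G, a ∉ commutator G ∧ A = subgroupA a}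

/-- `𝒞(G) = {C(N) | N ≤ G_3, |G_3 : N| = p}`. Normality of `N` is what makes `G/N` meaningful;
it is automatic when `G` has class at most `3` (see `normal_of_le_third`). -/
def familyC (p : ℕ) (G : Type*) [Group G] : Set (Subgroup G) :=
  {C | ∃ (N : Subgroup G) (_ : N.Normal), N ≤ third G ∧ N.relIndex (third G) = p ∧
    C = subgroupC N}

/-- In a group of nilpotence class `3`, every subgroup of `G_3` is normal. -/
theorem normal_of_le_third {G : Type*} [Group G] [Group.IsNilpotent G]
    (hc : Group.nilpotencyClass G = 3) {N : Subgroup G} (hN : N ≤ third G) : N.Normal := by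
  have h : (⊤ : Subgroup G).lowerCentralSeries 3 = ⊥ := by
    rw [← hc]; exact Subgroup.lowerCentralSeries_nilpotencyClass
  have h3 : ⁅third G, (⊤ : Subgroup G)⁆ = ⊥ := by
    rw [← h]; rfl
  have h4 := Subgroup.commutator_eq_bot_iff_le_centralizer.mp h3
  refine ⟨fun n hn g => ?_⟩
  have := Subgroup.mem_centralizer_iff.mp (h4 (hN hn)) g (Subgroup.mem_top g)
  rw [this, mul_inv_cancel_right]
  exact hn

end CaminaGroups

/-!
Commutators induce an alternating `𝔽_p`-bilinear form `B` on `V = G / G'` with values in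
`W = G' / G_3`, and the Camina condition says that `B(x, ·)` is onto `W` for every `x ≠ 0`.

* Composing `B` with the nonzero functionals of `W` gives nondegenerate alternating forms, so the
  Pfaffian of the generic such form, of degree `dim V / 2` in `dim W` variables, has only the
  trivial zero. By Chevalley–Warning `2 dim W ≤ dim V`, that is `|G' : G_3|² ≤ |G : G'|`.
* If `N` has index `p` in `G_3`, commutators induce a pairing `W × V → G_3 / N` with right radical
  `C(N) / G'`. A dimension count shows that `C(N) = A(b)` for every `b ∈ C(N) ∖ G'`.
* If `A(b) ∉ 𝒞(G)`, then `b` lies in no `C(N)`, so `[G', b] = G_3`. As `c ↦ [c, b]` factors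
  through `W`, this gives `|G_3| ≤ |G' : G_3|`.
-/

namespace CaminaGroups

open Module
open scoped commutatorElement

section AlternatingMatrix

open Matrix

variable {ι κ R K : Type*} [Fintype ι] [Fintype κ]

/-- A square matrix is alternating if the quadratic form `x ↦ xᵀ A x` vanishes identically.
Over any commutative ring this amounts to `Aᵀ = -A` with zero diagonal, see
`isAlternating_iff`. -/
def IsAlternating [CommRing R] (A : Matrix ι ι R) : Prop :=
  ∀ x : ι → R, x ⬝ᵥ A *ᵥ x = 0

theorem isAlternating_iff [CommRing R] {A : Matrix ι ι R} :
    IsAlternating A ↔ (∀ i, A i i = 0) ∧ ∀ i j, A j i = -A i j := by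
  classical
  refine ⟨fun h => ?_, fun ⟨hdiag, hskew⟩ x => ?_⟩
  · have hdiag : ∀ i, A i i = 0 := fun i => by simpa using h (Pi.single i 1)
    refine ⟨hdiag, fun i j => eq_neg_of_add_eq_zero_left ?_⟩
    have hpolar := h (Pi.single i 1 + Pi.single j 1)
    rw [mulVec_add, dotProduct_add, add_dotProduct, add_dotProduct, h, h] at hpolar
    simpa using hpolar
  · simp only [dotProduct, mulVec, Finset.mul_sum]
    rw [← Finset.sum_product']
    refine Finset.sum_involution (fun ij _ => ij.swap) ?_ ?_ (by simp) (by simp)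
    · rintro ⟨i, j⟩ -
      simp only [Prod.fst_swap, Prod.snd_swap, hskew i j]
      ring
    · rintro ⟨i, j⟩ - hne heq
      obtain rfl : j = i := congrArg Prod.fst heq
      simp [hdiag] at hne

theorem IsAlternating.reindex [CommRing R] {A : Matrix ι ι R} (hA : IsAlternating A) (e : ι ≃ κ) :
    IsAlternating (A.reindex e e) := by
  rw [isAlternating_iff] at hA ⊢
  exact ⟨fun _ => hA.1 _, fun _ _ => hA.2 _ _⟩

theorem IsAlternating.map [CommRing R] [CommRing K] {A : Matrix ι ι R} (hA : IsAlternating A)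
    (f : R →+* K) : IsAlternating (A.map f) := by
  rw [isAlternating_iff] at hA ⊢
  exact ⟨fun i => by simp [hA.1], fun i j => by simp [hA.2 i j]⟩

theorem IsAlternating.schurComplement [CommRing R] [DecidableEq ι] {A : Matrix ι ι R}
    {B : Matrix ι κ R} {C : Matrix κ ι R} {D : Matrix κ κ R} [Invertible A]
    (h : IsAlternating (fromBlocks A B C D)) : IsAlternating (D - C * ⅟A * B) := by
  intro x
  have hcancel : A *ᵥ ⅟A *ᵥ B *ᵥ x = B *ᵥ x := by
    rw [mulVec_mulVec, mul_invOf_self, one_mulVec]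
  have hx := h (Sum.elim (-(⅟A *ᵥ B *ᵥ x)) x)
  simpa [-invOf_eq_nonsing_inv, fromBlocks_mulVec, mulVec_neg, sub_mulVec, neg_add_eq_sub, hcancel,
    ← mulVec_mulVec] using hx

theorem IsAlternating.toBlocks₁₁ [CommRing R] {A : Matrix (ι ⊕ κ) (ι ⊕ κ) R}
    (hA : IsAlternating A) : IsAlternating A.toBlocks₁₁ := by
  rw [isAlternating_iff] at hA ⊢
  exact ⟨fun _ => hA.1 _, fun _ _ => hA.2 _ _⟩

theorem IsAlternating.det_fin_two [CommRing R] {A : Matrix (Fin 2) (Fin 2) R}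
    (hA : IsAlternating A) : A.det = A 0 1 ^ 2 := by
  rw [isAlternating_iff] at hA
  rw [Matrix.det_fin_two, hA.1, hA.2 0 1]
  ring

theorem IsAlternating.isSquare_det_of_field [Field K] [DecidableEq ι] {A : Matrix ι ι K}
    (hA : IsAlternating A) : IsSquare A.det := by
  induction hn : Fintype.card ι using Nat.strong_induction_on generalizing ι with
  | _ n ih =>
  rcases eq_or_ne A 0 with rfl | hne
  · cases isEmpty_or_nonempty ι <;> simp
  obtain ⟨i, j, hij⟩ : ∃ i j, A i j ≠ 0 := by
    contrapose! hne
    exact Matrix.ext hne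
  have hinj : Function.Injective ![i, j] := by
    rw [injective_pair_iff_ne]
    rintro rfl
    exact hij ((isAlternating_iff.1 hA).1 i)
  let e : Fin 2 ⊕ ↥(Set.range ![i, j])ᶜ ≃ ι :=
    ((Equiv.ofInjective _ hinj).sumCongr (Equiv.refl _)).trans (Equiv.Set.sumCompl _)
  let M := A.reindex e.symm e.symm
  have hM : IsAlternating M := hA.reindex e.symm
  have hdet : M.toBlocks₁₁.det = A i j ^ 2 := hM.toBlocks₁₁.det_fin_two
  let := M.toBlocks₁₁.invertibleOfIsUnitDet (hdet ▸ (pow_ne_zero 2 hij).isUnit)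
  have hcard : Fintype.card ↥(Set.range ![i, j])ᶜ < n :=
    hn ▸ Fintype.card_subtype_lt (x := i) (by simp)
  rw [← det_reindex_self e.symm A, ← fromBlocks_toBlocks (A.reindex e.symm e.symm),
    det_fromBlocks₁₁, hdet]
  rw [← fromBlocks_toBlocks M] at hM
  exact (IsSquare.sq _).mul (ih _ hcard hM.schurComplement rfl)

theorem IsAlternating.isSquare_det [CommRing R] [IsDomain R] [IsIntegrallyClosed R]
    [DecidableEq ι] {A : Matrix ι ι R} (hA : IsAlternating A) : IsSquare A.det := by
  obtain ⟨y, hy⟩ := (hA.map (algebraMap R (FractionRing R))).isSquare_det_of_field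
  have hy' : algebraMap R (FractionRing R) A.det = y ^ 2 := by
    rw [pow_two, ← hy, RingHom.map_det, RingHom.mapMatrix_apply]
  obtain ⟨x, rfl⟩ := IsIntegrallyClosed.exists_algebraMap_eq_of_isIntegral_pow (R := R) (x := y)
    two_pos (hy' ▸ isIntegral_algebraMap)
  refine ⟨x, IsFractionRing.injective R (FractionRing R) ?_⟩
  rw [hy', pow_two, map_mul]

end AlternatingMatrix

section MatrixPencil

open MvPolynomial

variable {σ ι R F : Type*}

/-- The generic member `∑ i, X i • A i` of the linear system of matrices spanned by the `A i`. -/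
noncomputable def genericMatrix [Fintype σ] [CommRing R] (A : σ → Matrix ι ι R) :
    Matrix ι ι (MvPolynomial σ R) :=
  Matrix.of fun j k => ∑ i, C (A i j k) * X i

theorem map_eval_genericMatrix [Fintype σ] [CommRing R] (A : σ → Matrix ι ι R) (t : σ → R) :
    (genericMatrix A).map (eval t) = ∑ i, t i • A i := by
  ext j k
  simp [genericMatrix, Matrix.sum_apply, mul_comm]

theorem eval_det_genericMatrix [Fintype σ] [Fintype ι] [CommRing R] [DecidableEq ι]
    (A : σ → Matrix ι ι R) (t : σ → R) :
    eval t (genericMatrix A).det = (∑ i, t i • A i).det := by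
  rw [RingHom.map_det, RingHom.mapMatrix_apply, map_eval_genericMatrix]

theorem isAlternating_genericMatrix [Fintype σ] [Fintype ι] [CommRing R] {A : σ → Matrix ι ι R}
    (hA : ∀ i, IsAlternating (A i)) : IsAlternating (genericMatrix A) := by
  simp only [isAlternating_iff] at hA ⊢
  exact ⟨fun j => by simp [genericMatrix, (hA _).1],
    fun j k => by simp [genericMatrix, (hA _).2 j k]⟩

theorem isHomogeneous_det [Fintype ι] [CommRing R] [DecidableEq ι]
    {A : Matrix ι ι (MvPolynomial σ R)} {d : ℕ} (hA : ∀ i j, (A i j).IsHomogeneous d) :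
    A.det.IsHomogeneous (Fintype.card ι * d) := by
  rw [Matrix.det_apply, ← mem_homogeneousSubmodule]
  refine Submodule.sum_mem _ fun g _ => ?_
  rw [Units.smul_def]
  refine zsmul_mem ?_ _
  simpa using IsHomogeneous.prod Finset.univ (fun i => A (g i) i) (fun _ => d) fun i _ => hA _ _

theorem totalDegree_det_genericMatrix_le [Fintype σ] [Fintype ι] [CommRing R] [DecidableEq ι]
    (A : σ → Matrix ι ι R) :
    (genericMatrix A).det.totalDegree ≤ Fintype.card ι := by
  have hlin : ∀ j k, (genericMatrix A j k).IsHomogeneous 1 := fun j k =>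
    IsHomogeneous.sum _ _ _ fun i _ => by
      simpa using (isHomogeneous_C σ (A i j k)).mul (isHomogeneous_X R i)
  simpa using (isHomogeneous_det hlin).totalDegree_le

/-- Chevalley–Warning for the Pfaffian of the generic member, a form of degree `card ι / 2` in
`card σ` variables whose only zero is the origin. -/
theorem two_mul_card_le_of_det_ne_zero [Fintype σ] [Fintype ι] [Field F] [Finite F]
    [DecidableEq ι] [Nonempty ι] {A : σ → Matrix ι ι F} (hA : ∀ i, IsAlternating (A i))
    (hdet : ∀ t : σ → F, t ≠ 0 → (∑ i, t i • A i).det ≠ 0) :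
    2 * Fintype.card σ ≤ Fintype.card ι := by
  classical
  have := Fintype.ofFinite F
  obtain ⟨p, hchar⟩ := CharP.exists F
  obtain ⟨q, hq⟩ := (isAlternating_genericMatrix hA).isSquare_det
  have heval (t : σ → F) : eval t q = 0 ↔ (∑ i, t i • A i).det = 0 := by
    rw [← eval_det_genericMatrix, hq, map_mul, mul_self_eq_zero]
  have hzero (t : σ → F) : eval t q = 0 ↔ t = 0 := by
    refine ⟨fun ht => of_not_not fun hne => hdet t hne ((heval t).1 ht), ?_⟩
    rintro rfl
    rw [heval]
    simp
  have hdeg : Fintype.card σ ≤ q.totalDegree := by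
    by_contra! hlt
    have hdvd := char_dvd_card_solutions p hlt
    simp only [hzero, Fintype.card_unique, Nat.dvd_one] at hdvd
    exact CharP.char_ne_one F p hdvd
  rcases eq_or_ne q 0 with rfl | hq0
  · rw [totalDegree_zero] at hdeg
    lia
  · have hle := totalDegree_det_genericMatrix_le A
    rw [hq, totalDegree_mul_of_isDomain hq0 hq0] at hle
    lia

end MatrixPencil

section BilinearMap

variable {F V W : Type*} [Field F] [AddCommGroup V] [Module F V] [AddCommGroup W] [Module F W]

theorem separatingLeft_compr₂_of_surjective {B : V →ₗ[F] V →ₗ[F] W}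
    (hsurj : ∀ x ≠ 0, Function.Surjective (B x)) {f : W →ₗ[F] F} (hf : f ≠ 0) :
    (B.compr₂ f).SeparatingLeft := by
  refine fun x hx => of_not_not fun hx0 => hf (LinearMap.ext fun w => ?_)
  obtain ⟨y, rfl⟩ := hsurj x hx0 w
  exact hx y

theorem isAlternating_toMatrix₂ {ι : Type*} [Fintype ι] [DecidableEq ι] (v : Basis ι F V)
    {b : V →ₗ[F] V →ₗ[F] F} (hb : b.IsAlt) : IsAlternating (LinearMap.toMatrix₂ v v b) := by
  rw [isAlternating_iff]
  exact ⟨fun i => by simp [hb.self_eq_zero], fun i j => by simp [← hb.neg (v i) (v j)]⟩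

theorem two_mul_finrank_le_of_surjective [Finite F] [FiniteDimensional F V]
    [FiniteDimensional F W] [Nontrivial V] {B : V →ₗ[F] V →ₗ[F] W} (hB : B.IsAlt)
    (hsurj : ∀ x ≠ 0, Function.Surjective (B x)) : 2 * finrank F W ≤ finrank F V := by
  let v := finBasis F V
  let w := finBasis F W
  have : Nonempty (Fin (finrank F V)) := ⟨⟨0, finrank_pos⟩⟩
  let A (i) := LinearMap.toMatrix₂ v v (B.compr₂ (w.coord i))
  have hA i : IsAlternating (A i) :=
    isAlternating_toMatrix₂ v fun x => by simp [hB.self_eq_zero]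
  have hsum (t : Fin (finrank F W) → F) :
      ∑ i, t i • A i = LinearMap.toMatrix₂ v v (B.compr₂ (∑ i, t i • w.coord i)) := by
    ext j k
    simp [A, Matrix.sum_apply]
  have hdet : ∀ t : Fin (finrank F W) → F, t ≠ 0 → (∑ i, t i • A i).det ≠ 0 := by
    intro t ht
    rw [hsum, ← LinearMap.separatingLeft_iff_det_ne_zero]
    refine separatingLeft_compr₂_of_surjective hsurj fun h => ht (funext fun i => ?_)
    simpa [Finsupp.single_apply] using LinearMap.congr_fun h (w i)
  simpa using two_mul_card_le_of_det_ne_zero hA hdet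

theorem two_mul_finrank_le_of_isotropic [FiniteDimensional F V] {b : V →ₗ[F] V →ₗ[F] F}
    (hb : b.SeparatingLeft) {K : Submodule F V} (hK : ∀ x ∈ K, ∀ y ∈ K, b x y = 0) :
    2 * finrank F K ≤ finrank F V := by
  have hinj : Function.Injective b :=
    LinearMap.ker_eq_bot.1 (LinearMap.separatingLeft_iff_ker_eq_bot.1 hb)
  have hle : K.map b ≤ K.dualAnnihilator := by
    rintro _ ⟨x, hx, rfl⟩
    exact (Submodule.mem_dualAnnihilator _).2 (hK x hx)
  have hfin := Submodule.finrank_mono hle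
  rw [← (Submodule.equivMapOfInjective b hinj K).finrank_eq] at hfin
  have := Subspace.finrank_add_finrank_dualAnnihilator_eq K
  lia

theorem finrank_ker_flip_add [FiniteDimensional F V] [FiniteDimensional F W]
    (T : W →ₗ[F] V →ₗ[F] F) :
    finrank F (LinearMap.ker T.flip) + finrank F W =
      finrank F V + finrank F (LinearMap.ker T) := by
  have hW := Subspace.finrank_add_finrank_dualAnnihilator_eq (LinearMap.ker T)
  have hV := LinearMap.finrank_range_add_finrank_ker T.flip
  rw [LinearMap.dualAnnihilator_ker_eq_range_flip] at hW
  lia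

/-- The right radical of `T` is isotropic for all forms `x, y ↦ T (B x y) v`, hence of dimension
at most `dim V / 2`. Comparing with the rank of `T`, this forces the left radical to be zero, so
the right radical is isotropic for `B` itself and has the dimension of `ker (B x)`. -/
theorem ker_flip_eq_ker [FiniteDimensional F V] [FiniteDimensional F W] {B : V →ₗ[F] V →ₗ[F] W}
    (hsurj : ∀ x ≠ 0, Function.Surjective (B x)) (hdim : 2 * finrank F W ≤ finrank F V)
    {T : W →ₗ[F] V →ₗ[F] F} (hT : T ≠ 0)
    (hBT : ∀ x ∈ LinearMap.ker T.flip, ∀ y ∈ LinearMap.ker T.flip, T (B x y) = 0)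
    {x : V} (hx : x ∈ LinearMap.ker T.flip) (hx0 : x ≠ 0) :
    LinearMap.ker T.flip = LinearMap.ker (B x) := by
  have hrank := finrank_ker_flip_add T
  have hker : LinearMap.ker T = ⊥ := by
    obtain ⟨v, hv⟩ : ∃ v, T.flip v ≠ 0 := by
      contrapose! hT
      exact LinearMap.ext₂ fun w v => LinearMap.congr_fun (hT v) w
    have hiso := two_mul_finrank_le_of_isotropic (separatingLeft_compr₂_of_surjective hsurj hv)
      fun x hx y hy => LinearMap.congr_fun (hBT x hx y hy) v
    rw [← Submodule.finrank_eq_zero (R := F)]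
    lia
  have hle : LinearMap.ker T.flip ≤ LinearMap.ker (B x) := fun y hy =>
    LinearMap.ker_eq_bot'.1 hker _ (hBT x hx y hy)
  have hBx := LinearMap.finrank_range_add_finrank_ker (B x)
  rw [LinearMap.range_eq_top.2 (hsurj x hx0), finrank_top] at hBx
  exact Submodule.eq_of_le_of_finrank_le hle (by lia)

end BilinearMap

section AbelianGroup

/-- A pairing of abelian groups, written multiplicatively, as a bilinear map over `ZMod n`. -/
def zmodBilin (n : ℕ) {A B C : Type*} [CommGroup A] [CommGroup B] [AddCommGroup C]
    [Module (ZMod n) (Additive A)] [Module (ZMod n) (Additive B)] [Module (ZMod n) C]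
    (f : A →* B →* Multiplicative C) : Additive A →ₗ[ZMod n] Additive B →ₗ[ZMod n] C :=
  (AddMonoidHom.mk' (fun a => (f a.toMul).toAdditiveLeft.toZModLinearMap n) fun a a' =>
    LinearMap.ext fun b => congrArg Multiplicative.toAdd
      (DFunLike.congr_fun (map_mul f a.toMul a'.toMul) b.toMul)).toZModLinearMap n

theorem exists_ker_eq_of_index_eq {p : ℕ} [Fact p.Prime] {P : Type*} [Group P] {K : Subgroup P}
    [K.Normal] (hK : K.index = p) : ∃ φ : P →* Multiplicative (ZMod p), φ.ker = K := by
  let e : P ⧸ K ≃* Multiplicative (ZMod p) := mulEquivOfPrimeCardEq (p := p) hK (by simp)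
  exact ⟨e.toMonoidHom.comp (QuotientGroup.mk' K), by ext; simp⟩

theorem exists_le_index_eq {p : ℕ} [Fact p.Prime] {P : Type*} [Group P] [Finite P]
    (hP : IsPGroup p P) {H : Subgroup P} (hH : H ≠ ⊤) : ∃ K, H ≤ K ∧ K.index = p := by
  obtain ⟨n, hn⟩ := IsPGroup.iff_card.1 hP
  obtain ⟨m, hm⟩ := IsPGroup.iff_card.1 (hP.to_subgroup H)
  have hp := (Fact.out : p.Prime)
  have hlt : m < n := by
    rw [← Nat.pow_lt_pow_iff_right hp.one_lt, ← hn, ← hm]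
    exact (Subgroup.card_le_card_group H).lt_of_ne fun h => hH (Subgroup.eq_top_of_card_eq H h)
  obtain ⟨k, rfl⟩ := Nat.exists_eq_add_one_of_ne_zero hlt.ne_bot
  obtain ⟨K, hK, hle⟩ := Sylow.exists_subgroup_card_pow_prime_le p
    (hn ▸ pow_dvd_pow p k.le_succ) H hm (Nat.le_of_lt_succ hlt)
  refine ⟨K, hle, Nat.eq_of_mul_eq_mul_left (pow_pos hp.pos k) ?_⟩
  rw [← pow_succ, ← hn, ← hK, K.card_mul_index]

end AbelianGroup

section Commutator

variable {G : Type*} [Group G]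

theorem mem_centralizerMod_iff {N : Subgroup G} [N.Normal] {S : Set G} {x : G} :
    x ∈ centralizerMod N S ↔ ∀ s ∈ S, ⁅s, x⁆ ∈ N := by
  rw [mem_centralizerMod]
  refine forall₂_congr fun s _ => ?_
  have hinv : s⁻¹ * x⁻¹ * s * x = (x * s)⁻¹ * (s * x) := by group
  have hcomm : ⁅s, x⁆ = s * x * (x * s)⁻¹ := by group
  rw [hinv, hcomm]
  exact ‹N.Normal›.mem_comm_iff

theorem mem_subgroupA {a x : G} : x ∈ subgroupA a ↔ ⁅a, x⁆ ∈ third G := by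
  simp [subgroupA, mem_centralizerMod_iff]

theorem mem_subgroupC {N : Subgroup G} [N.Normal] {x : G} :
    x ∈ subgroupC N ↔ ∀ c ∈ commutator G, ⁅c, x⁆ ∈ N :=
  mem_centralizerMod_iff

theorem commutatorElement_mem_third {c : G} (hc : c ∈ commutator G) (y : G) : ⁅c, y⁆ ∈ third G :=
  Subgroup.commutator_mem_commutator hc (Subgroup.mem_top y)

theorem commutatorElement_commutatorElement_mem {N : Subgroup G} [N.Normal] {x y : G}
    (hx : x ∈ subgroupC N) (hy : y ∈ subgroupC N) (z : G) : ⁅⁅x, y⁆, z⁆ ∈ N := by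
  have hmap : QuotientGroup.mk' N '' (commutator G : Set G) = commutator (G ⧸ N) := by
    rw [← Subgroup.coe_map, commutator_def, Subgroup.map_commutator,
      Subgroup.map_top_of_surjective _ (QuotientGroup.mk'_surjective N), commutator_def]
  rw [subgroupC, centralizerMod, Subgroup.mem_comap, hmap] at hx hy
  have hcenter := commutator_centralizer_commutator_le_center (G ⧸ N)
    (Subgroup.commutator_mem_commutator hx hy)
  rw [← QuotientGroup.eq_one_iff, ← QuotientGroup.mk'_apply, map_commutatorElement,
    map_commutatorElement, commutatorElement_eq_one_iff_mul_comm]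
  exact (Subgroup.mem_center_iff.1 hcenter (QuotientGroup.mk' N z)).symm

/-- The pairing `(h, g) ↦ χ [h, g]` attached to a homomorphism `χ` on `[H, G]` that is invariant
under conjugation; invariance makes it multiplicative in both variables. -/
def commutatorPairing (H : Subgroup G) [H.Normal] {M : Type*} [CommGroup M]
    (χ : ↥⁅H, (⊤ : Subgroup G)⁆ →* M) (hχ : ∀ g z, χ (MulAut.conjNormal g z) = χ z) :
    H →* G →* M :=
  let comm (h : H) (g : G) : ↥⁅H, (⊤ : Subgroup G)⁆ :=
    ⟨⁅(h : G), g⁆, Subgroup.commutator_mem_commutator h.2 (Subgroup.mem_top g)⟩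
  MonoidHom.mk' (fun h => MonoidHom.mk' (fun g => χ (comm h g)) fun g g' => by
      rw [← hχ g (comm h g'), ← map_mul]
      exact congrArg χ (Subtype.ext (by
        simp [comm, commutatorElement_mul_right_eq_mul_conj, mul_assoc])))
    fun h h' => MonoidHom.ext fun g => by
      change χ (comm (h * h') g) = χ (comm h g) * χ (comm h' g)
      rw [mul_comm, ← hχ h (comm h' g), ← map_mul]
      exact congrArg χ (Subtype.ext (by
        simp [comm, commutatorElement_mul_left_eq_conj_mul, mul_assoc]))

/-- The section `G' / G_3`. -/
abbrev DerivedQuotient (G : Type*) [Group G] : Type _ :=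
  ↥(commutator G) ⧸ (third G).subgroupOf (commutator G)

namespace DerivedQuotient

instance : CommGroup (DerivedQuotient G) :=
  { (inferInstance : Group (DerivedQuotient G)) with
    mul_comm := by
      rintro ⟨c⟩ ⟨d⟩
      refine QuotientGroup.eq.2 (Subgroup.mem_subgroupOf.2 ?_)
      have h : (((c * d)⁻¹ * (d * c) : commutator G) : G) = ⁅(d : G)⁻¹, (c : G)⁻¹⁆ := by
        push_cast
        group
      rw [h]
      exact commutatorElement_mem_third (inv_mem d.2) _ }

theorem mk_eq_one_iff {c : commutator G} : (c : DerivedQuotient G) = 1 ↔ (c : G) ∈ third G := by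
  rw [QuotientGroup.eq_one_iff, Subgroup.mem_subgroupOf]

theorem mk_conj (g : G) (c : commutator G) :
    ((MulAut.conjNormal g c : commutator G) : DerivedQuotient G) = c := by
  refine (QuotientGroup.eq.2 (Subgroup.mem_subgroupOf.2 ?_)).symm
  have h : ((c⁻¹ * MulAut.conjNormal g c : commutator G) : G) = ⁅(c : G)⁻¹, g⁆ := by
    push_cast [MulAut.conjNormal_apply]
    group
  rw [h]
  exact commutatorElement_mem_third (inv_mem c.2) g

end DerivedQuotient

open DerivedQuotient

/-- The commutator pairing `G × G → G' / G_3`. -/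
def derivedPairing (G : Type*) [Group G] : G →* G →* DerivedQuotient G :=
  (commutatorPairing ⊤
    (QuotientGroup.mk' ((third G).subgroupOf (commutator G)) : commutator G →* DerivedQuotient G)
    mk_conj).comp (Subgroup.topEquiv (G := G)).symm.toMonoidHom

theorem derivedPairing_eq_one_iff {x y : G} : derivedPairing G x y = 1 ↔ ⁅x, y⁆ ∈ third G :=
  mk_eq_one_iff

/-- The pairing `G / G' × G / G' → G' / G_3` induced by commutators. -/
def abelianizationPairing (G : Type*) [Group G] :
    Abelianization G →* Abelianization G →* DerivedQuotient G :=
  Abelianization.lift (Abelianization.lift (derivedPairing G).flip).flip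

/-- The pairing `G' / G_3 × G / G' → M` induced by commutators and a homomorphism `χ` on `G_3`,
for `G_3` central. -/
def thirdPairing (hz : third G ≤ Subgroup.center G) {M : Type*} [CommGroup M] (χ : third G →* M) :
    DerivedQuotient G →* Abelianization G →* M :=
  QuotientGroup.lift _
    (Abelianization.lift (commutatorPairing (commutator G) χ fun g z => congrArg χ <|
      Subtype.ext <| by simp [Subgroup.mem_center_iff.1 (hz z.2) g]).flip).flip
    fun c hc => by
      ext y
      refine (congrArg χ (Subtype.ext ?_)).trans (map_one χ)
      exact commutatorElement_eq_one_iff_mul_comm.2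
        (Subgroup.mem_center_iff.1 (hz (Subgroup.mem_subgroupOf.1 hc)) y).symm

theorem thirdPairing_mk_of (hz : third G ≤ Subgroup.center G) {M : Type*} [CommGroup M]
    (χ : third G →* M) (c : commutator G) (x : G) :
    thirdPairing hz χ c (.of x) = χ ⟨⁅(c : G), x⁆, commutatorElement_mem_third c.2 x⟩ := rfl

/-- The values `[c, b]` with `c ∈ G'` form a subgroup of `G_3` of order at most `|G' : G_3|`. -/
theorem exists_relIndex_eq_mem_subgroupC_of_card_lt {p : ℕ} [Fact p.Prime] [Finite G]
    (hp : IsPGroup p G) (hz : third G ≤ Subgroup.center G)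
    (hcard : Nat.card (DerivedQuotient G) < Nat.card (third G)) (b : G) :
    ∃ N : Subgroup G, N ≤ third G ∧ N.relIndex (third G) = p ∧ ∀ c ∈ commutator G, ⁅c, b⁆ ∈ N := by
  let : CommGroup (third G) :=
    { mul_comm := fun z w => Subtype.ext (Subgroup.mem_center_iff.1 (hz w.2) z) }
  let f : DerivedQuotient G →* third G :=
    (thirdPairing hz (MonoidHom.id (third G))).flip (Abelianization.of b)
  have hf : f.range ≠ ⊤ := fun h =>
    hcard.not_ge (Nat.card_le_card_of_surjective f (MonoidHom.range_eq_top.1 h))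
  obtain ⟨K, hK, hKp⟩ := exists_le_index_eq (hp.to_subgroup (third G)) hf
  refine ⟨K.map (third G).subtype, Subgroup.map_subtype_le K, ?_, fun c hc => ?_⟩
  · rw [Subgroup.relIndex, Subgroup.subgroupOf,
      Subgroup.comap_map_eq_self_of_injective (third G).subtype_injective, hKp]
  · exact Subgroup.mem_map_of_mem _ (hK ⟨((⟨c, hc⟩ : commutator G) : DerivedQuotient G), rfl⟩)

end Commutator

section BilinearForms

variable {G : Type*} [Group G]

theorem exists_ofMul_of_eq (v : Additive (Abelianization G)) :
    ∃ x : G, Additive.ofMul (Abelianization.of x) = v :=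
  QuotientGroup.mk_surjective v.toMul

theorem ofMul_of_eq_zero_iff {x : G} :
    Additive.ofMul (Abelianization.of x) = 0 ↔ x ∈ commutator G := by
  rw [ofMul_eq_zero, ← MonoidHom.mem_ker, Abelianization.ker_of]

variable (p : ℕ) [Module (ZMod p) (Additive (Abelianization G))]
  [Module (ZMod p) (Additive (DerivedQuotient G))]

/-- The pairing `G / G' × G / G' → G' / G_3` as a bilinear map over `ZMod p`. -/
def commutatorForm : Additive (Abelianization G) →ₗ[ZMod p] Additive (Abelianization G) →ₗ[ZMod p]
    Additive (DerivedQuotient G) :=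
  zmodBilin p (abelianizationPairing G)

theorem commutatorForm_eq_zero_iff {x y : G} :
    commutatorForm p (.ofMul (.of x)) (.ofMul (.of y)) = 0 ↔ ⁅x, y⁆ ∈ third G :=
  ofMul_eq_zero.trans derivedPairing_eq_one_iff

theorem commutatorForm_isAlt : (commutatorForm (G := G) p).IsAlt := by
  intro v
  obtain ⟨x, rfl⟩ := exists_ofMul_of_eq v
  rw [commutatorForm_eq_zero_iff, commutatorElement_self]
  exact one_mem _

variable {p} in
/-- For `G_3` central, the pairing `G' / G_3 × G / G' → ZMod p` given by a homomorphism
`φ` from `G_3` to a group of order `p`, as a bilinear map over `ZMod p`. -/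
def thirdForm (hz : third G ≤ Subgroup.center G) (φ : third G →* Multiplicative (ZMod p)) :
    Additive (DerivedQuotient G) →ₗ[ZMod p] Additive (Abelianization G) →ₗ[ZMod p] ZMod p :=
  zmodBilin p (thirdPairing hz φ)

variable {p} {hz : third G ≤ Subgroup.center G} {N : Subgroup G}
  {φ : third G →* Multiplicative (ZMod p)} (hφ : φ.ker = N.subgroupOf (third G))
include hφ

theorem thirdForm_eq_zero_iff {c : commutator G} {x : G} :
    thirdForm hz φ (.ofMul (c : DerivedQuotient G)) (.ofMul (.of x)) = 0 ↔ ⁅(c : G), x⁆ ∈ N := by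
  refine toAdd_eq_zero.trans ?_
  rw [toMul_ofMul, toMul_ofMul, thirdPairing_mk_of, ← MonoidHom.mem_ker, hφ,
    Subgroup.mem_subgroupOf]

theorem mem_ker_flip_thirdForm [N.Normal] {x : G} :
    Additive.ofMul (Abelianization.of x) ∈ LinearMap.ker (thirdForm hz φ).flip ↔
      x ∈ subgroupC N := by
  rw [LinearMap.mem_ker, LinearMap.ext_iff, mem_subgroupC]
  refine ⟨fun h c hc => (thirdForm_eq_zero_iff hφ (c := ⟨c, hc⟩)).1 (h _), fun h w => ?_⟩
  obtain ⟨c, rfl⟩ : ∃ c : commutator G, Additive.ofMul (c : DerivedQuotient G) = w :=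
    QuotientGroup.mk_surjective w.toMul
  exact (thirdForm_eq_zero_iff hφ).2 (h c c.2)

theorem thirdForm_ne_zero (hN : ¬third G ≤ N) : thirdForm hz φ ≠ 0 := by
  refine fun h => hN (Subgroup.commutator_le.2 fun c hc x _ => ?_)
  refine (thirdForm_eq_zero_iff hφ (hz := hz) (c := ⟨c, hc⟩)).1 ?_
  rw [h]
  rfl

theorem thirdForm_commutatorForm_eq_zero [N.Normal] {v w : Additive (Abelianization G)}
    (hv : v ∈ LinearMap.ker (thirdForm hz φ).flip) (hw : w ∈ LinearMap.ker (thirdForm hz φ).flip) :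
    thirdForm hz φ (commutatorForm p v w) = 0 := by
  obtain ⟨x, rfl⟩ := exists_ofMul_of_eq v
  obtain ⟨y, rfl⟩ := exists_ofMul_of_eq w
  rw [mem_ker_flip_thirdForm hφ] at hv hw
  ext u
  obtain ⟨z, rfl⟩ := exists_ofMul_of_eq u
  exact (thirdForm_eq_zero_iff hφ (c := ⟨⁅x, y⁆, _⟩)).2
    (commutatorElement_commutatorElement_mem hv hw z)

end BilinearForms

section CaminaGroup

variable {G : Type*} [Group G]

theorem IsCamina.exists_commutatorElement_eq (hG : IsCamina G) {x : G} (hx : x ∉ commutator G)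
    {g : G} (hg : g ∈ commutator G) : ∃ y, ⁅x, y⁆ = g := by
  have hconj : g⁻¹ * x ∈ conjugatesOf x := by
    rw [hG x hx]
    refine ⟨x⁻¹ * g⁻¹ * x, ?_, by group⟩
    simpa using (inferInstance : (commutator G).Normal).conj_mem _ (inv_mem hg) x⁻¹
  obtain ⟨y, hy⟩ := isConj_iff.1 hconj
  refine ⟨y, ?_⟩
  have hcomm : ⁅x, y⁆ = x * (y * x * y⁻¹)⁻¹ := by group
  rw [hcomm, hy]
  group

theorem IsCamina.derivedPairing_surjective (hG : IsCamina G) {x : G} (hx : x ∉ commutator G) :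
    Function.Surjective (derivedPairing G x) := by
  rintro ⟨g⟩
  obtain ⟨y, hy⟩ := hG.exists_commutatorElement_eq hx g.2
  exact ⟨y, congrArg _ (Subtype.ext hy)⟩

theorem IsCamina.commutatorForm_surjective (hG : IsCamina G) (p : ℕ)
    [Module (ZMod p) (Additive (Abelianization G))]
    [Module (ZMod p) (Additive (DerivedQuotient G))] {v : Additive (Abelianization G)}
    (hv : v ≠ 0) : Function.Surjective (commutatorForm p v) := by
  obtain ⟨x, rfl⟩ := exists_ofMul_of_eq v
  intro w
  obtain ⟨y, hy⟩ := hG.derivedPairing_surjective (mt ofMul_of_eq_zero_iff.2 hv) w.toMul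
  exact ⟨.ofMul (.of y), congrArg Additive.ofMul hy⟩

theorem exists_notMem_commutator [Nontrivial (DerivedQuotient G)] : ∃ x : G, x ∉ commutator G := by
  by_contra! h
  have htop : commutator G = ⊤ := (Subgroup.eq_top_iff' _).2 h
  have hthird : third G = commutator G := by
    rw [third, htop, ← commutator_def, htop]
  obtain ⟨⟨c⟩, hc⟩ := exists_ne (1 : DerivedQuotient G)
  exact hc (DerivedQuotient.mk_eq_one_iff.2 (by rw [hthird]; exact c.2))

theorem nontrivial_derivedQuotient (hz : third G ≤ Subgroup.center G) (hne : third G ≠ ⊥) :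
    Nontrivial (DerivedQuotient G) := by
  refine not_subsingleton_iff_nontrivial.1 fun _ => hne ?_
  have hle : commutator G ≤ third G := fun c hc =>
    DerivedQuotient.mk_eq_one_iff.1
      (Subsingleton.elim ((⟨c, hc⟩ : commutator G) : DerivedQuotient G) 1)
  exact Subgroup.commutator_top_right_eq_bot_iff_le_center.2 (hle.trans hz)

variable [Finite G] {p : ℕ} [Fact p.Prime]

/-- If `x ^ p ∉ G'`, then `y ↦ [x, y] ^ p = [x ^ p, y]` would map onto `G' / G_3`, making
the `p`-th power map of this nontrivial `p`-group bijective. -/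
theorem IsCamina.pow_mem_commutator (hG : IsCamina G) (hp : IsPGroup p G)
    [Nontrivial (DerivedQuotient G)] (x : G) : x ^ p ∈ commutator G := by
  by_contra hx
  have hsurj : Function.Surjective fun w : DerivedQuotient G => w ^ p := by
    intro w
    obtain ⟨y, hy⟩ := hG.derivedPairing_surjective hx w
    exact ⟨derivedPairing G x y, by simpa using hy⟩
  have hinj := Finite.injective_iff_surjective.2 hsurj
  have hpW : IsPGroup p (DerivedQuotient G) := (hp.to_subgroup _).to_quotient _
  obtain ⟨w, hw⟩ := exists_prime_orderOf_dvd_card' p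
    (hpW.card_eq_or_dvd.resolve_left Finite.one_lt_card.ne')
  have hw1 : w = 1 := hinj (by simp [← hw, pow_orderOf_eq_one])
  rw [hw1, orderOf_one] at hw
  exact (Fact.out : p.Prime).one_lt.ne hw

theorem IsCamina.abelianization_pow_eq_one (hG : IsCamina G) (hp : IsPGroup p G)
    [Nontrivial (DerivedQuotient G)] (v : Abelianization G) : v ^ p = 1 := by
  obtain ⟨x, rfl⟩ := QuotientGroup.mk_surjective v
  exact Abelianization.commutator_subset_ker Abelianization.of (hG.pow_mem_commutator hp x)

theorem IsCamina.derivedQuotient_pow_eq_one (hG : IsCamina G) (hp : IsPGroup p G)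
    [Nontrivial (DerivedQuotient G)] (w : DerivedQuotient G) : w ^ p = 1 := by
  obtain ⟨x, hx⟩ := exists_notMem_commutator (G := G)
  obtain ⟨y, rfl⟩ := hG.derivedPairing_surjective hx w
  rw [← map_pow]
  exact Abelianization.commutator_subset_ker _ (hG.pow_mem_commutator hp y)

theorem IsCamina.two_mul_finrank_derivedQuotient_le (hG : IsCamina G)
    [Nontrivial (DerivedQuotient G)] [Module (ZMod p) (Additive (Abelianization G))]
    [Module (ZMod p) (Additive (DerivedQuotient G))] :
    2 * finrank (ZMod p) (Additive (DerivedQuotient G)) ≤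
      finrank (ZMod p) (Additive (Abelianization G)) := by
  obtain ⟨x, hx⟩ := exists_notMem_commutator (G := G)
  have : Nontrivial (Additive (Abelianization G)) :=
    nontrivial_of_ne _ 0 (mt ofMul_of_eq_zero_iff.1 hx)
  exact two_mul_finrank_le_of_surjective (commutatorForm_isAlt p)
    fun v hv => hG.commutatorForm_surjective p hv

theorem IsCamina.card_derivedQuotient_sq_le (hG : IsCamina G) (hp : IsPGroup p G) :
    Nat.card (DerivedQuotient G) ^ 2 ≤ (commutator G).index := by
  rcases subsingleton_or_nontrivial (DerivedQuotient G) with h | h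
  · rw [Nat.card_unique, one_pow]
    exact Nat.one_le_iff_ne_zero.2 Subgroup.index_ne_zero_of_finite
  have : Module (ZMod p) (Additive (Abelianization G)) :=
    AddCommGroup.zmodModule (hG.abelianization_pow_eq_one hp)
  have : Module (ZMod p) (Additive (DerivedQuotient G)) :=
    AddCommGroup.zmodModule (hG.derivedQuotient_pow_eq_one hp)
  have hW := Module.natCard_eq_pow_finrank (K := ZMod p) (V := Additive (DerivedQuotient G))
  have hV := Module.natCard_eq_pow_finrank (K := ZMod p) (V := Additive (Abelianization G))
  rw [Nat.card_zmod] at hW hV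
  calc Nat.card (DerivedQuotient G) ^ 2
      = p ^ (2 * finrank (ZMod p) (Additive (DerivedQuotient G))) := by
        rw [mul_comm, pow_mul]
        exact congrArg (· ^ 2) hW
    _ ≤ p ^ finrank (ZMod p) (Additive (Abelianization G)) :=
        Nat.pow_le_pow_right (Fact.out : p.Prime).pos hG.two_mul_finrank_derivedQuotient_le
    _ = (commutator G).index := hV.symm

theorem IsCamina.subgroupC_eq_subgroupA (hG : IsCamina G) (hp : IsPGroup p G)
    (hz : third G ≤ Subgroup.center G) {N : Subgroup G} [N.Normal]
    (hN : N.relIndex (third G) = p) {b : G} (hb : b ∉ commutator G) (hbN : b ∈ subgroupC N) :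
    subgroupC N = subgroupA b := by
  have hNthird : ¬third G ≤ N := fun hle =>
    (Fact.out : p.Prime).one_lt.ne ((Subgroup.relIndex_eq_one.2 hle).symm.trans hN)
  have : Nontrivial (DerivedQuotient G) :=
    nontrivial_derivedQuotient hz fun h => hNthird (h ▸ bot_le)
  have : Module (ZMod p) (Additive (Abelianization G)) :=
    AddCommGroup.zmodModule (hG.abelianization_pow_eq_one hp)
  have : Module (ZMod p) (Additive (DerivedQuotient G)) :=
    AddCommGroup.zmodModule (hG.derivedQuotient_pow_eq_one hp)
  obtain ⟨φ, hφ⟩ := exists_ker_eq_of_index_eq (K := N.subgroupOf (third G)) hN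
  have hker := ker_flip_eq_ker (fun v hv => hG.commutatorForm_surjective p hv)
    hG.two_mul_finrank_derivedQuotient_le (thirdForm_ne_zero hφ (hz := hz) hNthird)
    (fun v hv w hw => thirdForm_commutatorForm_eq_zero hφ hv hw)
    ((mem_ker_flip_thirdForm hφ).2 hbN) (mt ofMul_of_eq_zero_iff.1 hb)
  ext x
  rw [← mem_ker_flip_thirdForm hφ (hz := hz), hker, LinearMap.mem_ker, commutatorForm_eq_zero_iff,
    mem_subgroupA]

theorem IsCamina.card_third_le_of_subgroupA_notMem (hG : IsCamina G) (hp : IsPGroup p G)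
    (hz : third G ≤ Subgroup.center G) {b : G} (hb : b ∉ commutator G)
    (hbC : subgroupA b ∉ familyC p G) :
    Nat.card (third G) ≤ Nat.card (DerivedQuotient G) := by
  by_contra! hlt
  obtain ⟨N, hN, hNp, hbN⟩ := exists_relIndex_eq_mem_subgroupC_of_card_lt hp hz hlt b
  have : N.Normal := ⟨fun n hn g => by
    rwa [Subgroup.mem_center_iff.1 (hz (hN hn)) g, mul_inv_cancel_right]⟩
  exact hbC ⟨N, this, hN, hNp, (hG.subgroupC_eq_subgroupA hp hz hNp hb (mem_subgroupC.2 hbN)).symm⟩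

end CaminaGroup

end CaminaGroups

open CaminaGroups

theorem corollary5p4 (p : ℕ) (hp : p.Prime) (G : Type*) [Group G] [Finite G]
    (hpG : IsPGroup p G) (hCamina : CaminaGroups.IsCamina G)
    (hnil : Group.IsNilpotent G) (hclass : Group.nilpotencyClass G = 3)
    (hCA : CaminaGroups.familyC p G ⊂ CaminaGroups.familyA G) :
    (Nat.card (CaminaGroups.third G) : ℝ) ≤ Real.sqrt ((commutator G).index : ℝ) := by
  have : Fact p.Prime := ⟨hp⟩
  have hz : third G ≤ Subgroup.center G :=
    Subgroup.commutator_top_right_eq_bot_iff_le_center.1 <|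
      (congrArg (⊤ : Subgroup G).lowerCentralSeries hclass.symm).trans
        Subgroup.lowerCentralSeries_nilpotencyClass
  obtain ⟨-, _, ⟨b, hb, rfl⟩, hbC⟩ := Set.ssubset_iff_exists.1 hCA
  have hle := hCamina.card_third_le_of_subgroupA_notMem hpG hz hb hbC
  have hsq := hCamina.card_derivedQuotient_sq_le hpG
  refine Real.le_sqrt_of_sq_le ?_
  exact_mod_cast (Nat.pow_le_pow_left hle 2).trans hsq
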